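/- Let $G$ be a connected simple undirected graph with vertices $1,\dots,n$ ($n\ge 2$) and edges $1,\dots,m$, and let $B\in\{-1,0,1\}^{n\times m}$ be an oriented incidence matrix of $G$: each edge $k$ is given an orientation, and $B_{ik}$ is $1$ if $i$ is the head of $k$, $-1$ if $i$ is the tail of $k$, and $0$ otherwise. Let $\mathbb{T}=\mathbb{R}/2\pi\mathbb{Z}$, and let $f:\mathbb{T}\to\mathbb{R}$ be an odd $C^1$ function with derivative $f'$ such that, for some constant $b\in(0,\frac{\pi}{n-1}]$ and all $\theta\in\mathbb{T}$, $f'(\theta)>0$ whenever $\cos\theta>\cos b$, and $f'(\theta)<0$ whenever $\cos\theta<\cos b$. For $\theta\in\mathbb{T}^m$ put $F(\theta)=[f(\theta_1)\,\ldots\,f(\theta_m)]^T\in\mathbb{R}^m$ and $F'(\theta)=\mathrm{diag}\{f'(\theta_1),\dots,f'(\theta_m)\}\in\mathbb{R}^{m\times m}$. Let $$R=\begin{bmatrix}\mathbf 0_{n-1}^T\\ I_{n-1}\end{bmatrix}\in\mathbb{R}^{n\times(n-1)},\qquad S=\begin{bmatrix}-\mathbf 1_{n-1}^T\\ I_{n-1}\end{bmatrix}\in\mathbb{R}^{n\times(n-1)},$$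 and let integer matrices also act as $\mathbb{Z}$-linear maps between tori. For a vector $a\in\mathbb{R}^m$ of edge weights put $A=\mathrm{diag}(a)$, $$\Phi=\{\varphi\in\mathbb{T}^n : BAF(B^T\varphi)=0\},\qquad L^\flat(\mu)=R^TBAF'(B^TR\mu)B^TR\quad(\mu\in\mathbb{T}^{n-1}).$$ Then there is a set $Z\subset\mathbb{R}^m$ of Lebesgue measure zero such that for every $a\in\mathbb{R}^m\setminus Z$ the matrix $L^\flat(\mu)$ is invertible for all $\mu\in S^T\Phi$. Moreover, for every $a\in\mathbb{R}^m\setminus Z$, all points of the set $S^T\Phi\subset\mathbb{T}^{n-1}$ are isolated. -/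

import Mathlib

/-- The derivative `f'` of a function on the circle `𝕋 = ℝ / 2πℤ` in the direction of the
counterclockwise unit vector field. -/
noncomputable def circleDeriv (f : Real.Angle → ℝ) (θ : Real.Angle) : ℝ :=
  deriv (fun t : ℝ => f (θ + (t : Real.Angle))) 0

/-- An integer matrix acting as a `ℤ`-linear map between tori. -/
noncomputable def torusMulVec {l q : ℕ} (M : Matrix (Fin l) (Fin q) ℤ)
    (θ : Fin q → Real.Angle) : Fin l → Real.Angle :=
  fun i => ∑ j, M i j • θ j

/-- An integer matrix regarded as a real matrix. -/
def realMatrix {l q : ℕ} (M : Matrix (Fin l) (Fin q) ℤ) : Matrix (Fin l) (Fin q) ℝ :=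
  M.map (fun z : ℤ => (z : ℝ))

/-- The oriented incidence matrix of the graph whose edge `k` goes from `tail k` to `head k`. -/
def incidence {n m : ℕ} (tail head : Fin m → Fin n) : Matrix (Fin n) (Fin m) ℤ :=
  Matrix.of fun i k => if i = head k then 1 else if i = tail k then -1 else 0

/-- `R = [0ᵀ ; I]`, of size `n × (n - 1)` with `n = p + 1`. -/
def matR (p : ℕ) : Matrix (Fin (p + 1)) (Fin p) ℤ :=
  Matrix.of fun i j => if i = j.succ then 1 else 0

/-- `S = [-1ᵀ ; I]`, of size `n × (n - 1)` with `n = p + 1`. -/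
def matS (p : ℕ) : Matrix (Fin (p + 1)) (Fin p) ℤ :=
  Matrix.of fun i j => if i = 0 then -1 else if i = j.succ then 1 else 0

/-- `Φ = {φ ∈ 𝕋ⁿ : B A F(Bᵀ φ) = 0}`, where `A = diag(a)` and `F` applies `f` to every entry. -/
def equilibria {n m : ℕ} (f : Real.Angle → ℝ) (B : Matrix (Fin n) (Fin m) ℤ)
    (a : Fin m → ℝ) : Set (Fin n → Real.Angle) :=
  {φ | (realMatrix B * Matrix.diagonal a).mulVec
    (fun k => f (torusMulVec B.transpose φ k)) = 0}

/-- `Sᵀ Φ ⊆ 𝕋ⁿ⁻¹`: the equilibria with the phases measured relative to that of the first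
vertex. -/
def reducedEquilibria {p m : ℕ} (f : Real.Angle → ℝ) (B : Matrix (Fin (p + 1)) (Fin m) ℤ)
    (a : Fin m → ℝ) : Set (Fin p → Real.Angle) :=
  torusMulVec (matS p).transpose '' equilibria f B a

/-- The weighted Laplacian `L(μ) = B A F'(Bᵀ R μ) Bᵀ`. -/
noncomputable def weightedLaplacian {p m : ℕ} (f : Real.Angle → ℝ)
    (B : Matrix (Fin (p + 1)) (Fin m) ℤ) (a : Fin m → ℝ) (μ : Fin p → Real.Angle) :
    Matrix (Fin (p + 1)) (Fin (p + 1)) ℝ :=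
  realMatrix B * Matrix.diagonal a
    * Matrix.diagonal
        (fun k => circleDeriv f (torusMulVec B.transpose (torusMulVec (matR p) μ) k))
    * (realMatrix B).transpose

/-- The reduced weighted Laplacian `L♭(μ) = Rᵀ L(μ) R`. -/
noncomputable def reducedLaplacian {p m : ℕ} (f : Real.Angle → ℝ)
    (B : Matrix (Fin (p + 1)) (Fin m) ℤ) (a : Fin m → ℝ) (μ : Fin p → Real.Angle) :
    Matrix (Fin p) (Fin p) ℝ :=
  (realMatrix (matR p)).transpose * weightedLaplacian f B a μ * realMatrix (matR p)

open MeasureTheory Set Filter Topology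

/-! Ground the first vertex and lift to ℝ^p. With C the incidence matrix without its first row and h
the lift of f, equilibria become zeros of g(a, x) = C A h(Cᵀx), and the reduced Laplacian is ∂g/∂x.
A bad a has a zero (a, x) with ∂g/∂x singular.

If Dg is onto there, a is a critical value of the projection of a C¹ manifold of zeros to weight
space. Both have dimension m, so Sard's theorem needs only C¹ (`addHaar_image_fst_eq_zero`).

If Dg is not onto, some v ≠ 0 annihilates its range. The a-directions force Cᵀv to vanish on every
edge where h ≠ 0. The other edges sit at 0 or π, where h' takes one of two nonzero values. Hence
det(C A diag(c) Cᵀ) = 0 for one of finitely many c with nonzero entries, each a null condition on a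
(`volume_det_mul_diagonal_mul_transpose_eq_zero`).

Isolation follows from invertibility of ∂g/∂x. -/

/-! ### Parametric Sard argument -/

/-- Near a point of s the zero set of g is parametrised by ker Dg, which has the dimension of X, so
the first projection becomes a self-map of X. A vertical tangent vector (0, y) makes its derivative
singular, and equidimensional Sard applies. A countable subcover globalises this. -/
theorem addHaar_image_fst_eq_zero {X Y W : Type*}
    [NormedAddCommGroup X] [NormedSpace ℝ X] [FiniteDimensional ℝ X]
    [NormedAddCommGroup Y] [NormedSpace ℝ Y] [FiniteDimensional ℝ Y]
    [NormedAddCommGroup W] [NormedSpace ℝ W] [FiniteDimensional ℝ W]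
    [MeasurableSpace X] [BorelSpace X] (ν : Measure X) [ν.IsAddHaarMeasure]
    (hdim : Module.finrank ℝ W = Module.finrank ℝ Y)
    {g : X × Y → W} (hg : ContDiff ℝ 1 g) {s : Set (X × Y)}
    (hzero : ∀ z ∈ s, g z = 0)
    (hsurj : ∀ z ∈ s, Function.Surjective (fderiv ℝ g z))
    (hker : ∀ z ∈ s, ∃ y : Y, y ≠ 0 ∧ fderiv ℝ g z (0, y) = 0) :
    ν (Prod.fst '' s) = 0 := by
  suffices H : ∀ z ∈ s, ∃ U ∈ 𝓝 z, ν (Prod.fst '' (s ∩ U)) = 0 by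
    choose! U hU hν using H
    obtain ⟨t, hts, htc, hcov⟩ := TopologicalSpace.countable_cover_nhdsWithin
      (fun z hz => mem_nhdsWithin_of_mem_nhds (hU z hz) : ∀ z ∈ s, U z ∈ 𝓝[s] z)
    refine measure_mono_null (t := ⋃ z ∈ t, Prod.fst '' (s ∩ U z)) ?_
      ((measure_biUnion_null_iff htc).2 fun z hz => hν z (hts hz))
    rintro _ ⟨z, hz, rfl⟩
    obtain ⟨w, hw, hzw⟩ := mem_iUnion₂.1 (hcov hz)
    exact mem_iUnion₂.2 ⟨w, hw, z, ⟨hz, hzw⟩, rfl⟩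
  intro z₀ hz₀
  set D := fderiv ℝ g z₀ with hD
  have hDs : D.range = ⊤ := LinearMap.range_eq_top.2 (hsurj z₀ hz₀)
  have hfin : Module.finrank ℝ D.ker = Module.finrank ℝ X := by
    have h := LinearMap.finrank_range_add_finrank_ker (D : X × Y →ₗ[ℝ] W)
    rw [hDs, finrank_top, Module.finrank_prod] at h
    omega
  obtain ⟨P, hP⟩ := D.ker_closedComplemented_of_finiteDimensional_range
  let e : D.ker ≃L[ℝ] X := ContinuousLinearEquiv.ofFinrankEq hfin
  let L : X × Y →L[ℝ] X := (e : D.ker →L[ℝ] X).comp P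
  have hinj : Function.Injective (D.prod L) := by
    rw [injective_iff_map_eq_zero]
    intro v hv
    obtain ⟨h1, h2⟩ := Prod.ext_iff.1 hv
    have h1 : v ∈ D.ker := h1
    have h2 : e (P v) = 0 := h2
    rw [map_eq_zero_iff _ e.injective, hP ⟨v, h1⟩] at h2
    exact congrArg Subtype.val h2
  let E : (X × Y) ≃L[ℝ] (W × X) :=
    (LinearEquiv.ofInjectiveOfFinrankEq (D.prod L : X × Y →ₗ[ℝ] W × X) hinj
      (by simp only [Module.finrank_prod]; omega)).toContinuousLinearEquiv
  -- This local diffeomorphism straightens the zero set of g into {0} × X.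
  let Ψ : X × Y → W × X := fun z => (g z, L z)
  have hgd : ∀ z, HasFDerivAt g (fderiv ℝ g z) z := fun z =>
    (hg.differentiable one_ne_zero z).hasFDerivAt
  have hΨd : ∀ z, HasFDerivAt Ψ ((fderiv ℝ g z).prod L) z := fun z =>
    (hgd z).prodMk L.hasFDerivAt
  have hΨc : ContDiffAt ℝ 1 Ψ z₀ := (hg.prodMk L.contDiff).contDiffAt
  have hE : HasFDerivAt Ψ (E : X × Y →L[ℝ] W × X) z₀ := hΨd z₀
  let φ := hΨc.toOpenPartialHomeomorph Ψ hE one_ne_zero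
  have hφc : ContDiffAt ℝ 1 φ.symm (Ψ z₀) := hΨc.to_localInverse hE one_ne_zero
  have hleft : ∀ᶠ z in 𝓝 z₀, φ.symm (Ψ z) = z :=
    φ.eventually_left_inverse (hΨc.mem_toOpenPartialHomeomorph_source hE one_ne_zero)
  have hdiff : ∀ᶠ z in 𝓝 z₀, DifferentiableAt ℝ φ.symm (Ψ z) :=
    (hΨd z₀).continuousAt.eventually
      ((hφc.eventually (by simp)).mono fun _ h => h.differentiableAt one_ne_zero)
  let h : X → X := fun u => (φ.symm (0, u)).1
  refine ⟨{z | (∀ᶠ w in 𝓝 z, φ.symm (Ψ w) = w) ∧ DifferentiableAt ℝ φ.symm (Ψ z)},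
    hleft.eventually_nhds.and hdiff, ?_⟩
  let N : Set X := {u | DifferentiableAt ℝ h u ∧ (fderiv ℝ h u).det = 0}
  refine measure_mono_null (t := h '' N) ?_
    (addHaar_image_eq_zero_of_det_fderivWithin_eq_zero ν
      (fun u hu => hu.1.hasFDerivAt.hasFDerivWithinAt) fun u hu => hu.2)
  rintro _ ⟨z, ⟨hzs, hzl, hzd⟩, rfl⟩
  have hΨz : Ψ z = (0, L z) := Prod.ext (hzero z hzs) rfl
  have hΦ := hzd.hasFDerivAt
  have hcomp : (fderiv ℝ φ.symm (Ψ z)).comp ((fderiv ℝ g z).prod L)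
      = ContinuousLinearMap.id ℝ (X × Y) :=
    (hΦ.comp z (hΨd z)).unique ((hasFDerivAt_id z).congr_of_eventuallyEq hzl)
  obtain ⟨y, hy0, hy⟩ := hker z hzs
  have hLy : fderiv ℝ φ.symm (Ψ z) (0, L (0, y)) = (0, y) := by
    have := DFunLike.congr_fun hcomp (0, y)
    simpa [hy] using this
  have hh : HasFDerivAt h ((ContinuousLinearMap.fst ℝ X Y).comp
      ((fderiv ℝ φ.symm (Ψ z)).comp (ContinuousLinearMap.inr ℝ W X))) (L z) := by
    have h1 : HasFDerivAt (fun u : X => ((0 : W), u)) (ContinuousLinearMap.inr ℝ W X) (L z) :=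
      (ContinuousLinearMap.inr ℝ W X).hasFDerivAt
    have h2 := (hΨz ▸ hΦ : HasFDerivAt φ.symm (fderiv ℝ φ.symm (Ψ z)) (0, L z)).comp (L z) h1
    exact ((ContinuousLinearMap.fst ℝ X Y).hasFDerivAt).comp (L z) h2
  refine ⟨L z, ⟨hh.differentiableAt, ?_⟩, ?_⟩
  · rw [hh.fderiv]
    by_contra hdet
    -- The derivative of h kills L (0, y); were it injective, L (0, y) and hence y would vanish.
    have hinj' := (LinearMap.equivOfDetNeZero _ hdet).injective
    have h0 : L (0, y) = 0 := hinj' (by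
      rw [map_zero]
      show (fderiv ℝ φ.symm (Ψ z) (0, L (0, y))).1 = 0
      rw [hLy])
    rw [h0] at hLy
    have : (0 : X × Y) = (0, y) := by rw [← hLy]; exact (map_zero _).symm
    exact hy0 (Prod.ext_iff.1 this).2.symm
  · show (φ.symm (0, L z)).1 = z.1
    rw [← hΨz, hzl.self_of_nhds]

/-! ### Generic invertibility for fixed nonzero edge factors -/

open Matrix in
-- At a = 1/c the matrix is C Cᵀ, which is invertible. So on each line of direction 1/c the
-- determinant has finitely many zeros, and Fubini gives a null set.
theorem volume_det_mul_diagonal_mul_transpose_eq_zero {p m : ℕ}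
    {C : Matrix (Fin p) (Fin m) ℝ} (hC : ∀ v, Cᵀ *ᵥ v = 0 → v = 0)
    {c : Fin m → ℝ} (hc : ∀ k, c k ≠ 0) :
    volume {a : Fin m → ℝ | (C * diagonal (fun k => a k * c k) * Cᵀ).det = 0} = 0 := by
  have hdet : IsUnit (C * Cᵀ) := by
    rw [← Matrix.mulVec_injective_iff_isUnit, ← Matrix.coe_mulVecLin, injective_iff_map_eq_zero]
    intro v hv
    apply hC
    rw [← dotProduct_self_eq_zero]
    have hv : (C * Cᵀ) *ᵥ v = 0 := hv
    rw [mulVec_transpose, ← dotProduct_mulVec, ← mulVec_transpose, mulVec_mulVec, hv,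
      dotProduct_zero]
  have hdet' := (Matrix.isUnit_iff_isUnit_det _).1 hdet
  set s : Set (Fin m → ℝ) := {a | (C * diagonal (fun k => a k * c k) * Cᵀ).det ≠ 0} with hs
  have hcont : Continuous fun a : Fin m → ℝ => (C * diagonal (fun k => a k * c k) * Cᵀ).det := by
    fun_prop
  have hsm : MeasurableSet s := (isOpen_ne.preimage hcont).measurableSet
  have key : ∀ᵐ a : Fin m → ℝ, a ∈ s := by
    refine ae_mem_of_ae_add_linearMap_mem
      (LinearMap.toSpanSingleton ℝ _ fun k => (c k)⁻¹) volume volume hsm fun a => ?_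
    set A := C * diagonal (fun k => a k * c k) * Cᵀ with hA
    set Q := C * Cᵀ with hQ
    -- det(A + tQ) = det(t + AQ⁻¹) det Q, and the first factor is a monic characteristic polynomial
    -- in t.
    have hfin : {t : ℝ | (-(A * Q⁻¹)).charpoly.eval t = 0}.Finite :=
      Polynomial.finite_setOfPred_isRoot (Matrix.charpoly_monic _).ne_zero
    filter_upwards [hfin.countable.ae_notMem volume] with t ht
    have : C * diagonal (fun k => (a + (LinearMap.toSpanSingleton ℝ _ fun k => (c k)⁻¹) t) k * c k)
        * Cᵀ = (t • (1 : Matrix _ _ ℝ) - -(A * Q⁻¹)) * Q := by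
      have h1 : diagonal (fun k =>
          (a + (LinearMap.toSpanSingleton ℝ _ fun k => (c k)⁻¹) t) k * c k)
          = diagonal (fun k => a k * c k) + t • (1 : Matrix (Fin m) (Fin m) ℝ) := by
        ext i j
        by_cases hij : i = j
        · subst hij
          simp [add_mul, hc]
        · simp [hij]
      rw [h1, Matrix.mul_add, Matrix.add_mul, ← hA, sub_neg_eq_add, Matrix.add_mul,
        Matrix.mul_assoc A, Matrix.nonsing_inv_mul _ hdet']
      simp [add_comm, hQ]
    show _ ≠ _
    rw [this, det_mul]
    refine mul_ne_zero ?_ hdet'.ne_zero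
    intro h0
    apply ht
    show Polynomial.eval t _ = 0
    rw [Matrix.eval_charpoly, ← h0]
    simp [Matrix.scalar_apply, Matrix.smul_one_eq_diagonal]
  have := mem_ae_iff.1 key
  convert this using 2
  ext a
  simp [hs]

/-! ### The lifted flow balance and transversality -/

/-- The weighted flow balance `C A h(Cᵀ x)` with `A = diag(a)`, as a function of `(a, x)`. -/
noncomputable def flowBalance {p m : ℕ} (C : Matrix (Fin p) (Fin m) ℝ) (h : ℝ → ℝ)
    (z : (Fin m → ℝ) × (Fin p → ℝ)) : Fin p → ℝ :=
  C.mulVec fun k => z.1 k * h (C.transpose.mulVec z.2 k)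

/-- The derivative of `flowBalance C h` at `z`. -/
noncomputable def flowBalanceDeriv {p m : ℕ} (C : Matrix (Fin p) (Fin m) ℝ) (h : ℝ → ℝ)
    (z : (Fin m → ℝ) × (Fin p → ℝ)) : (Fin m → ℝ) × (Fin p → ℝ) →L[ℝ] (Fin p → ℝ) :=
  LinearMap.toContinuousLinearMap
    { toFun := fun w => C.mulVec fun k => w.1 k * h (C.transpose.mulVec z.2 k)
        + z.1 k * deriv h (C.transpose.mulVec z.2 k) * C.transpose.mulVec w.2 k
      map_add' := fun w w' => by
        rw [← Matrix.mulVec_add]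
        congr 1
        ext k
        simp only [Prod.fst_add, Prod.snd_add, Matrix.mulVec_add, Pi.add_apply]
        ring
      map_smul' := fun r w => by
        rw [← Matrix.mulVec_smul]
        congr 1
        ext k
        simp only [Prod.smul_fst, Prod.smul_snd, Matrix.mulVec_smul, Pi.smul_apply, smul_eq_mul,
          RingHom.id_apply]
        ring }

theorem flowBalanceDeriv_apply {p m : ℕ} (C : Matrix (Fin p) (Fin m) ℝ) (h : ℝ → ℝ)
    (z w : (Fin m → ℝ) × (Fin p → ℝ)) :
    flowBalanceDeriv C h z w = C.mulVec fun k => w.1 k * h (C.transpose.mulVec z.2 k)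
        + z.1 k * deriv h (C.transpose.mulVec z.2 k) * C.transpose.mulVec w.2 k := rfl

theorem contDiff_flowBalance {p m : ℕ} (C : Matrix (Fin p) (Fin m) ℝ) {h : ℝ → ℝ}
    (hh : ContDiff ℝ 1 h) : ContDiff ℝ 1 (flowBalance C h) := by
  unfold flowBalance Matrix.mulVec dotProduct
  fun_prop

theorem hasFDerivAt_flowBalance {p m : ℕ} (C : Matrix (Fin p) (Fin m) ℝ) {h : ℝ → ℝ}
    (hh : Differentiable ℝ h) (z : (Fin m → ℝ) × (Fin p → ℝ)) :
    HasFDerivAt (flowBalance C h) (flowBalanceDeriv C h z) z := by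
  let π₁ : Fin m → ((Fin m → ℝ) × (Fin p → ℝ) →L[ℝ] ℝ) := fun k =>
    (ContinuousLinearMap.proj k).comp (ContinuousLinearMap.fst ℝ _ _)
  let π₂ : Fin m → ((Fin m → ℝ) × (Fin p → ℝ) →L[ℝ] ℝ) := fun k =>
    (ContinuousLinearMap.proj k).comp
      ((C.transpose.mulVecLin.toContinuousLinearMap).comp (ContinuousLinearMap.snd ℝ _ _))
  have h1 : ∀ k, HasFDerivAt (fun z : (Fin m → ℝ) × (Fin p → ℝ) =>
      z.1 k * h (C.transpose.mulVec z.2 k)) _ z := fun k =>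
    ((π₁ k).hasFDerivAt (x := z)).mul
      ((hh (π₂ k z)).hasDerivAt.comp_hasFDerivAt z ((π₂ k).hasFDerivAt (x := z)))
  have h2 := (C.mulVecLin.toContinuousLinearMap.hasFDerivAt).comp z (hasFDerivAt_pi.2 h1)
  refine h2.congr_fderiv ?_
  refine ContinuousLinearMap.ext fun w => ?_
  rw [flowBalanceDeriv_apply]
  show C.mulVec _ = C.mulVec _
  congr 1
  ext k
  show z.1 k * (deriv h (C.transpose.mulVec z.2 k) * C.transpose.mulVec w.2 k)
    + h (C.transpose.mulVec z.2 k) * w.1 k = _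
  ring

open Matrix in
theorem exists_null_forall_flowBalance_eq_zero {p m : ℕ}
    {C : Matrix (Fin p) (Fin m) ℝ} (hC : ∀ v, Cᵀ *ᵥ v = 0 → v = 0)
    {h : ℝ → ℝ} (hh : ContDiff ℝ 1 h) {V : Set ℝ} (hVc : V.Countable) (hV0 : (0 : ℝ) ∉ V)
    (hV : ∀ t, h t = 0 → deriv h t ∈ V) :
    ∃ Z : Set (Fin m → ℝ), volume Z = 0 ∧ ∀ a ∉ Z, ∀ x, flowBalance C h (a, x) = 0 →
      ∀ y, flowBalanceDeriv C h (a, x) (0, y) = 0 → y = 0 := by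
  have hd := hh.differentiable one_ne_zero
  have hfd : ∀ z, fderiv ℝ (flowBalance C h) z = flowBalanceDeriv C h z := fun z =>
    (hasFDerivAt_flowBalance C hd z).fderiv
  let W : Set (Fin m → ℝ) := Set.pi univ fun _ => insert 1 V
  have hWc : W.Countable := Set.countable_univ_pi fun _ => hVc.insert 1
  let s : Set ((Fin m → ℝ) × (Fin p → ℝ)) := {z | flowBalance C h z = 0 ∧
    Function.Surjective (flowBalanceDeriv C h z) ∧
    ∃ y : Fin p → ℝ, y ≠ 0 ∧ flowBalanceDeriv C h z (0, y) = 0}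
  refine ⟨(⋃ c ∈ W, {a | (C * diagonal (fun k => a k * c k) * Cᵀ).det = 0}) ∪ Prod.fst '' s,
    measure_union_null ((measure_biUnion_null_iff hWc).2 fun c hc =>
      volume_det_mul_diagonal_mul_transpose_eq_zero hC fun k => ?_)
      (addHaar_image_fst_eq_zero volume rfl (contDiff_flowBalance C hh)
        (fun z hz => hz.1) (fun z hz => by rw [hfd]; exact hz.2.1)
        fun z hz => by simpa only [hfd] using hz.2.2), ?_⟩
  · rcases hc k (mem_univ k) with h1 | h1
    · rw [h1]; exact one_ne_zero
    · exact fun h0 => hV0 (h0 ▸ h1)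
  intro a ha x hx y hy
  by_contra hy0
  rw [mem_union, not_or] at ha
  obtain ⟨ha1, ha2⟩ := ha
  have hns : ¬ Function.Surjective (flowBalanceDeriv C h (a, x)) := fun hs =>
    ha2 ⟨(a, x), ⟨hx, hs, y, hy0, hy⟩, rfl⟩
  -- A nonzero covector v annihilating the range of the full derivative.
  obtain ⟨ℓ, hℓ0, hℓ⟩ := Submodule.exists_le_ker_of_lt_top _
    (lt_top_iff_ne_top.2 fun h => hns (LinearMap.range_eq_top.1 h))
  set v : Fin p → ℝ := fun i => ℓ (Pi.single i 1) with hv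
  have hℓv : ∀ w, ℓ w = v ⬝ᵥ w := by
    intro w
    rw [LinearMap.pi_apply_eq_sum_univ ℓ w, dotProduct]
    refine Finset.sum_congr rfl fun i _ => ?_
    rw [smul_eq_mul, mul_comm, hv]
    congr 2
    ext j
    simp [Pi.single_apply, eq_comm]
  have hv0 : v ≠ 0 := by
    intro h0
    refine hℓ0 (LinearMap.ext fun w => ?_)
    rw [hℓv, h0, zero_dotProduct, LinearMap.zero_apply]
  have hker : ∀ w : (Fin m → ℝ) × (Fin p → ℝ), Cᵀ *ᵥ v ⬝ᵥ (fun k => w.1 k * h ((Cᵀ *ᵥ x) k)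
      + a k * deriv h ((Cᵀ *ᵥ x) k) * (Cᵀ *ᵥ w.2) k) = 0 := by
    intro w
    rw [mulVec_transpose, ← dotProduct_mulVec, ← hℓv]
    exact hℓ ⟨w, rfl⟩
  have hu : ∀ k, h ((Cᵀ *ᵥ x) k) ≠ 0 → (Cᵀ *ᵥ v) k = 0 := by
    intro k hk
    have := hker (Pi.single k 1, 0)
    simp only [mulVec_zero, Pi.zero_apply, mul_zero, add_zero, dotProduct] at this
    rw [Finset.sum_eq_single k (fun j _ hj => by simp [hj]) (by simp)] at this
    simpa [hk] using this
  have hbal : C *ᵥ (fun k => a k * deriv h ((Cᵀ *ᵥ x) k) * (Cᵀ *ᵥ v) k) = 0 := by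
    refine dotProduct_eq_zero _ fun ξ => ?_
    have := hker (0, ξ)
    simp only [Pi.zero_apply, zero_mul, zero_add] at this
    rw [dotProduct_comm, dotProduct_mulVec, ← mulVec_transpose, ← this]
    exact Finset.sum_congr rfl fun k _ => by ring
  classical
  -- Where h ≠ 0 the entry of Cᵀv is 0, so h' may be replaced by 1 there; this leaves only countably
  -- many c.
  let c : Fin m → ℝ := fun k =>
    if h ((Cᵀ *ᵥ x) k) = 0 then deriv h ((Cᵀ *ᵥ x) k) else 1
  have hcW : c ∈ W := by
    intro k _
    by_cases hk : h ((Cᵀ *ᵥ x) k) = 0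
    · simp only [c, hk, if_true]; exact Or.inr (hV _ hk)
    · simp only [c, hk, if_false]; exact Or.inl rfl
  refine ha1 (mem_iUnion₂.2 ⟨c, hcW, Matrix.exists_mulVec_eq_zero_iff.1 ⟨v, hv0, ?_⟩⟩)
  rw [← mulVec_mulVec, ← mulVec_mulVec, ← hbal]
  congr 1
  ext k
  rw [mulVec_diagonal]
  by_cases hk : h ((Cᵀ *ᵥ x) k) = 0
  · simp only [c, hk, if_true]
  · simp only [hu k hk, mul_zero]

/-! ### Zeros of the coupling function -/

/-- Oddness and periodicity give h(0) = h(π) = 0, while h rises on [0, b] and falls on [b, π], so it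
is positive in between. The case b = π would give h(π) > 0. -/
theorem coupling_zero {h : ℝ → ℝ} (hh : Differentiable ℝ h)
    (hper : Function.Periodic h (2 * Real.pi)) (hodd : ∀ t, h (-t) = -h t)
    {b : ℝ} (hb_pos : 0 < b) (hb_le : b ≤ Real.pi)
    (hpos : ∀ t, Real.cos b < Real.cos t → 0 < deriv h t)
    (hneg : ∀ t, Real.cos t < Real.cos b → deriv h t < 0) :
    b < Real.pi ∧ ∀ t, -Real.pi < t → t ≤ Real.pi → h t = 0 → t = 0 ∨ t = Real.pi := by
  have h0 : h 0 = 0 := by have := hodd 0; rw [neg_zero] at this; linarith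
  have hπ : h Real.pi = 0 := by
    have h1 := hper (-Real.pi)
    rw [hodd, show -Real.pi + 2 * Real.pi = Real.pi by ring] at h1
    linarith
  have hmono : StrictMonoOn h (Icc 0 b) := by
    refine strictMonoOn_of_deriv_pos (convex_Icc 0 b) hh.continuous.continuousOn fun t ht => ?_
    rw [interior_Icc] at ht
    exact hpos t (Real.cos_lt_cos_of_nonneg_of_le_pi ht.1.le hb_le ht.2)
  have hanti : StrictAntiOn h (Icc b Real.pi) := by
    refine strictAntiOn_of_deriv_neg (convex_Icc b _) hh.continuous.continuousOn fun t ht => ?_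
    rw [interior_Icc] at ht
    exact hneg t (Real.cos_lt_cos_of_nonneg_of_le_pi hb_pos.le ht.2.le ht.1)
  have hbp : 0 < h b := by
    rw [← h0]; exact hmono ⟨le_rfl, hb_pos.le⟩ ⟨hb_pos.le, le_rfl⟩ hb_pos
  have hbπ : b < Real.pi := lt_of_le_of_ne hb_le fun h1 => by rw [h1, hπ] at hbp; exact hbp.false
  have hP : ∀ t, 0 < t → t < Real.pi → 0 < h t := by
    intro t ht htπ
    rcases le_total t b with htb | htb
    · rw [← h0]; exact hmono ⟨le_rfl, hb_pos.le⟩ ⟨ht.le, htb⟩ ht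
    · rw [← hπ]; exact hanti ⟨htb, htπ.le⟩ ⟨hbπ.le, le_rfl⟩ htπ
  refine ⟨hbπ, fun t ht1 ht2 hz => ?_⟩
  rcases lt_trichotomy t 0 with ht | ht | ht
  · have := hP (-t) (by linarith) (by linarith)
    rw [hodd, hz] at this
    simp at this
  · exact Or.inl ht
  · right
    by_contra hne
    have := hP t ht (lt_of_le_of_ne ht2 hne)
    rw [hz] at this
    exact this.false

/-! ### From the torus to grounded Euclidean coordinates -/

theorem torusMulVec_coe {l q : ℕ} (M : Matrix (Fin l) (Fin q) ℤ) (x : Fin q → ℝ) :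
    torusMulVec M (fun j => (x j : Real.Angle))
      = fun i => (((realMatrix M).mulVec x i : ℝ) : Real.Angle) := by
  ext i
  simp only [torusMulVec, Matrix.mulVec, dotProduct, realMatrix, Matrix.map_apply,
    ← Real.Angle.coe_coeHom, map_sum, ← map_zsmul, zsmul_eq_mul]

theorem torusMulVec_transpose_matS {p : ℕ} (φ : Fin (p + 1) → Real.Angle) (j : Fin p) :
    torusMulVec (matS p).transpose φ j = φ j.succ - φ 0 := by
  simp [torusMulVec, matS, Fin.sum_univ_succ, ite_smul, Fin.succ_ne_zero, sub_eq_neg_add]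

theorem torusMulVec_matR_zero {p : ℕ} (μ : Fin p → Real.Angle) :
    torusMulVec (matR p) μ 0 = 0 := by
  simp [torusMulVec, matR, (Fin.succ_ne_zero _).symm]

theorem torusMulVec_matR_succ {p : ℕ} (μ : Fin p → Real.Angle) (j : Fin p) :
    torusMulVec (matR p) μ j.succ = μ j := by
  simp [torusMulVec, matR, ite_smul]

theorem transpose_matR_mulVec {p : ℕ} (w : Fin (p + 1) → ℝ) (j : Fin p) :
    (realMatrix (matR p)).transpose.mulVec w j = w j.succ := by
  simp [realMatrix, matR, Matrix.mulVec, dotProduct]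

theorem torusMulVec_matR_transpose_matS {p : ℕ} (φ : Fin (p + 1) → Real.Angle)
    (i : Fin (p + 1)) :
    torusMulVec (matR p) (torusMulVec (matS p).transpose φ) i = φ i - φ 0 := by
  cases i using Fin.cases with
  | zero => rw [torusMulVec_matR_zero, sub_self]
  | succ j => rw [torusMulVec_matR_succ, torusMulVec_transpose_matS]

/-- The rows of an incidence matrix except the first one. -/
def reducedIncidence {p m : ℕ} (B : Matrix (Fin (p + 1)) (Fin m) ℤ) :
    Matrix (Fin p) (Fin m) ℝ :=
  (realMatrix (matR p)).transpose * realMatrix B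

/-- Since the columns of B sum to zero, balance at the first vertex follows from the others, and a
common phase shift leaves Bᵀφ unchanged. -/
theorem mem_reducedEquilibria_iff {p m : ℕ} {f : Real.Angle → ℝ}
    {B : Matrix (Fin (p + 1)) (Fin m) ℤ} (hB : ∀ k, ∑ i, B i k = 0) {a : Fin m → ℝ}
    {μ : Fin p → Real.Angle} :
    μ ∈ reducedEquilibria f B a ↔ (reducedIncidence B).mulVec
      (fun k => a k * f (torusMulVec B.transpose (torusMulVec (matR p) μ) k)) = 0 := by
  have hflow : ∀ w : Fin m → ℝ, (realMatrix B * Matrix.diagonal a).mulVec w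
      = (realMatrix B).mulVec fun k => a k * w k := by
    intro w
    rw [← Matrix.mulVec_mulVec]
    congr 1
    ext k
    rw [Matrix.mulVec_diagonal]
  simp only [reducedEquilibria, equilibria, reducedIncidence, ← Matrix.mulVec_mulVec, hflow]
  constructor
  · rintro ⟨φ, hφ, rfl⟩
    have hφ' : torusMulVec B.transpose (torusMulVec (matR p) (torusMulVec (matS p).transpose φ))
        = torusMulVec B.transpose φ := by
      rw [funext (torusMulVec_matR_transpose_matS φ)]
      ext k
      simp only [torusMulVec, Matrix.transpose_apply, smul_sub, Finset.sum_sub_distrib,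
        ← Finset.sum_smul, hB, zero_smul, sub_zero]
    rw [hφ', show (realMatrix B).mulVec _ = 0 from hφ, Matrix.mulVec_zero]
  · intro h
    refine ⟨torusMulVec (matR p) μ, ?_, ?_⟩
    · set w := (realMatrix B).mulVec fun k =>
        a k * f (torusMulVec B.transpose (torusMulVec (matR p) μ) k) with hw
      have hs : ∀ j : Fin p, w j.succ = 0 := fun j => by
        rw [← transpose_matR_mulVec w, h, Pi.zero_apply]
      have hsum : ∑ i, w i = 0 := by
        simp only [hw, Matrix.mulVec, dotProduct]
        rw [Finset.sum_comm]
        refine Finset.sum_eq_zero fun k _ => ?_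
        rw [← Finset.sum_mul]
        have : ∑ i, realMatrix B i k = 0 := by
          simp only [realMatrix, Matrix.map_apply, ← Int.cast_sum, hB, Int.cast_zero]
        rw [this, zero_mul]
      rw [Fin.sum_univ_succ, Finset.sum_eq_zero fun j _ => hs j, add_zero] at hsum
      show w = 0
      ext i
      cases i using Fin.cases with
      | zero => exact hsum
      | succ j => exact hs j
    · ext j
      rw [torusMulVec_transpose_matS, torusMulVec_matR_zero, torusMulVec_matR_succ, sub_zero]

theorem torusMulVec_transpose_torusMulVec_matR_coe {p m : ℕ}
    (B : Matrix (Fin (p + 1)) (Fin m) ℤ) (x : Fin p → ℝ) (k : Fin m) :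
    torusMulVec B.transpose (torusMulVec (matR p) fun j => (x j : Real.Angle)) k
      = (((reducedIncidence B).transpose.mulVec x k : ℝ) : Real.Angle) := by
  rw [torusMulVec_coe, torusMulVec_coe, Matrix.mulVec_mulVec, reducedIncidence,
    Matrix.transpose_mul, Matrix.transpose_transpose]
  rfl

theorem coe_mem_reducedEquilibria_iff {p m : ℕ} {f : Real.Angle → ℝ}
    {B : Matrix (Fin (p + 1)) (Fin m) ℤ} (hB : ∀ k, ∑ i, B i k = 0) {a : Fin m → ℝ}
    {x : Fin p → ℝ} :
    (fun j => (x j : Real.Angle)) ∈ reducedEquilibria f B a ↔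
      flowBalance (reducedIncidence B) (fun t : ℝ => f t) (a, x) = 0 := by
  simp only [mem_reducedEquilibria_iff hB, torusMulVec_transpose_torusMulVec_matR_coe,
    flowBalance]

theorem circleDeriv_coe (f : Real.Angle → ℝ) (t : ℝ) :
    circleDeriv f t = deriv (fun s : ℝ => f s) t := by
  have := deriv_comp_const_add (fun s : ℝ => f s) t 0
  simpa only [circleDeriv, Real.Angle.coe_add, add_zero] using this

theorem reducedLaplacian_coe_mulVec {p m : ℕ} (f : Real.Angle → ℝ)
    (B : Matrix (Fin (p + 1)) (Fin m) ℤ) (a : Fin m → ℝ) (x y : Fin p → ℝ) :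
    (reducedLaplacian f B a fun j => (x j : Real.Angle)).mulVec y
      = flowBalanceDeriv (reducedIncidence B) (fun t : ℝ => f t) (a, x) (0, y) := by
  have h1 : reducedLaplacian f B a (fun j => (x j : Real.Angle))
      = reducedIncidence B * (Matrix.diagonal a * (Matrix.diagonal (fun k =>
        deriv (fun t : ℝ => f t) ((reducedIncidence B).transpose.mulVec x k))
        * (reducedIncidence B).transpose)) := by
    simp only [reducedLaplacian, weightedLaplacian, torusMulVec_transpose_torusMulVec_matR_coe,
      circleDeriv_coe]
    simp only [reducedIncidence, Matrix.transpose_mul, Matrix.transpose_transpose,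
      Matrix.mul_assoc]
  rw [h1, flowBalanceDeriv_apply]
  simp only [← Matrix.mulVec_mulVec, Pi.zero_apply, zero_mul, zero_add]
  congr 1
  ext k
  rw [Matrix.mulVec_diagonal, Matrix.mulVec_diagonal, mul_assoc]

/-! ### Incidence matrices and connectedness -/

theorem sum_incidence {n m : ℕ} {tail head : Fin m → Fin n} (hne : ∀ k, tail k ≠ head k)
    (k : Fin m) : ∑ i, incidence tail head i k = 0 := by
  have : ∀ i, incidence tail head i k
      = (if i = head k then 1 else 0) - if i = tail k then 1 else 0 := by
    intro i
    by_cases h1 : i = head k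
    · have h2 : i ≠ tail k := fun h2 => hne k (h2.symm.trans h1)
      simp [incidence, h1, (hne k).symm]
    · by_cases h2 : i = tail k <;> simp [incidence, h1, h2, hne k]
  simp [this]

theorem transpose_realMatrix_incidence_mulVec {n m : ℕ} {tail head : Fin m → Fin n}
    (hne : ∀ k, tail k ≠ head k) (w : Fin n → ℝ) (k : Fin m) :
    (realMatrix (incidence tail head)).transpose.mulVec w k = w (head k) - w (tail k) := by
  have : ∀ i, ((incidence tail head i k : ℤ) : ℝ)
      = (if i = head k then 1 else 0) - if i = tail k then 1 else 0 := by
    intro i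
    by_cases h1 : i = head k
    · simp [incidence, h1, (hne k).symm]
    · by_cases h2 : i = tail k <;> simp [incidence, h1, h2, hne k]
  simp [Matrix.mulVec, dotProduct, realMatrix, this, sub_mul, Finset.sum_sub_distrib]

/-- Extended by 0 at the first vertex, v is constant along edges, hence constant by connectedness,
hence 0. -/
theorem eq_zero_of_transpose_reducedIncidence_mulVec_eq_zero {p m : ℕ}
    {G : SimpleGraph (Fin (p + 1))} (hG : G.Connected) (edge : Fin m ≃ G.edgeSet)
    {tail head : Fin m → Fin (p + 1)}
    (horient : ∀ k, s(tail k, head k) = (edge k : Sym2 (Fin (p + 1))))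
    (hne : ∀ k, tail k ≠ head k) (v : Fin p → ℝ)
    (hv : (reducedIncidence (incidence tail head)).transpose.mulVec v = 0) : v = 0 := by
  set w := (realMatrix (matR p)).mulVec v with hw
  have hw0 : w 0 = 0 := by
    simp [hw, realMatrix, matR, Matrix.mulVec, dotProduct, (Fin.succ_ne_zero _).symm]
  have hws : ∀ j : Fin p, w j.succ = v j := fun j => by
    simp [hw, realMatrix, matR, Matrix.mulVec, dotProduct]
  have hedge : ∀ k, w (head k) = w (tail k) := by
    intro k
    rw [← sub_eq_zero, ← transpose_realMatrix_incidence_mulVec hne, hw, Matrix.mulVec_mulVec]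
    rw [reducedIncidence, Matrix.transpose_mul, Matrix.transpose_transpose] at hv
    rw [hv, Pi.zero_apply]
  have hadj : ∀ i j, G.Adj i j → w i = w j := by
    intro i j hij
    obtain ⟨k, hk⟩ := edge.surjective ⟨s(i, j), hij⟩
    have h1 := horient k
    rw [hk] at h1
    rcases Sym2.eq_iff.1 h1 with ⟨h2, h3⟩ | ⟨h2, h3⟩
    · rw [← h2, ← h3, hedge]
    · rw [← h2, ← h3, hedge]
  have hwalk : ∀ i j, G.Walk i j → w i = w j := by
    intro i j walk
    induction walk with
    | nil => rfl
    | cons hij _ ih => rw [hadj _ _ hij, ih]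
  ext j
  rw [← hws, hwalk _ _ (hG.preconnected _ 0).some, hw0, Pi.zero_apply]

/-! ### Isolation and the main theorem -/

theorem isOpenMap_pi_angle_coe (p : ℕ) :
    IsOpenMap fun (x : Fin p → ℝ) j => (x j : Real.Angle) :=
  IsOpenMap.piMap (f := fun _ : Fin p => ((↑) : ℝ → Real.Angle))
    (fun _ => QuotientAddGroup.isOpenMap_coe)
    (by simp)

/-- An injective derivative is bounded below, so x is an isolated zero of the lift. The covering ℝ^p
→ 𝕋^p is open and carries the isolating neighbourhood down. -/
theorem exists_isOpen_inter_reducedEquilibria_eq_singleton {p m : ℕ} {f : Real.Angle → ℝ}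
    (hf : Differentiable ℝ (fun t : ℝ => f (t : Real.Angle)))
    {B : Matrix (Fin (p + 1)) (Fin m) ℤ} (hB : ∀ k, ∑ i, B i k = 0) {a : Fin m → ℝ}
    {x : Fin p → ℝ} (hx : (fun j => (x j : Real.Angle)) ∈ reducedEquilibria f B a)
    (hker : ∀ y, flowBalanceDeriv (reducedIncidence B) (fun t : ℝ => f t) (a, x) (0, y) = 0 →
      y = 0) :
    ∃ U : Set (Fin p → Real.Angle), IsOpen U ∧
      U ∩ reducedEquilibria f B a = {fun j => (x j : Real.Angle)} := by
  set g' := (flowBalanceDeriv (reducedIncidence B) (fun t : ℝ => f t) (a, x)).comp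
    (ContinuousLinearMap.inr ℝ (Fin m → ℝ) (Fin p → ℝ)) with hg'
  have hd : HasFDerivAt (fun y => flowBalance (reducedIncidence B) (fun t : ℝ => f t) (a, y))
      g' x :=
    (hasFDerivAt_flowBalance _ hf (a, x)).comp x (hasFDerivAt_prodMk_right a x)
  obtain ⟨K, -, hK⟩ := (g' : (Fin p → ℝ) →ₗ[ℝ] (Fin p → ℝ)).exists_antilipschitzWith
    (LinearMap.ker_eq_bot'.2 hker)
  obtain ⟨V, hVo, hxV, hV⟩ := mem_nhdsWithin.1 (hd.eventually_ne (c := 0) ⟨K, hK⟩)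
  refine ⟨_, isOpenMap_pi_angle_coe p V hVo, Subset.antisymm ?_ ?_⟩
  · rintro _ ⟨⟨y, hy, rfl⟩, hmem⟩
    by_contra hne
    exact hV ⟨hy, fun h => hne (by rw [mem_singleton_iff.1 h]; rfl)⟩
      ((coe_mem_reducedEquilibria_iff hB).1 hmem)
  · rintro _ rfl
    exact ⟨⟨x, hxV, rfl⟩, hx⟩

theorem theorem4
    -- a connected simple graph on `n = p + 1 ≥ 2` vertices with labelled, oriented edges
    (p m : ℕ) (hp : 1 ≤ p)
    (G : SimpleGraph (Fin (p + 1))) (hG : G.Connected)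
    (edge : Fin m ≃ G.edgeSet)
    (tail head : Fin m → Fin (p + 1))
    (horient : ∀ k, s(tail k, head k) = (edge k : Sym2 (Fin (p + 1))))
    -- the phase coupling function: `C¹`, odd, with the sign condition on its derivative
    (f : Real.Angle → ℝ)
    (hf : ContDiff ℝ 1 (fun t : ℝ => f (t : Real.Angle)))
    (hodd : ∀ θ, f (-θ) = -f θ)
    (b : ℝ) (hb_pos : 0 < b) (hb_le : b ≤ Real.pi / p)
    (hf_pos : ∀ θ : Real.Angle, Real.cos b < θ.cos → 0 < circleDeriv f θ)
    (hf_neg : ∀ θ : Real.Angle, θ.cos < Real.cos b → circleDeriv f θ < 0) :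
    ∃ Z : Set (Fin m → ℝ), MeasureTheory.volume Z = 0 ∧
      ∀ a : Fin m → ℝ, a ∉ Z →
        (∀ μ ∈ reducedEquilibria f (incidence tail head) a,
          IsUnit (reducedLaplacian f (incidence tail head) a μ)) ∧
        (∀ μ ∈ reducedEquilibria f (incidence tail head) a,
          ∃ U : Set (Fin p → Real.Angle), IsOpen U ∧
            U ∩ reducedEquilibria f (incidence tail head) a = {μ}) := by
  have hne : ∀ k, tail k ≠ head k := fun k =>
    ((horient k ▸ (edge k).2 : s(tail k, head k) ∈ G.edgeSet) : G.Adj _ _).ne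
  have hbπ : b ≤ Real.pi :=
    hb_le.trans (div_le_self Real.pi_pos.le (by exact_mod_cast hp))
  have hfd := hf.differentiable one_ne_zero
  have hB := sum_incidence hne
  obtain ⟨hb_lt, hzero⟩ := coupling_zero hfd
    (fun t => by simp only [Real.Angle.coe_add, Real.Angle.coe_two_pi, add_zero])
    (fun t => by simp only [Real.Angle.coe_neg, hodd]) hb_pos hbπ
    (fun t ht => by rw [← circleDeriv_coe]; exact hf_pos _ (by rwa [Real.Angle.cos_coe]))
    (fun t ht => by rw [← circleDeriv_coe]; exact hf_neg _ (by rwa [Real.Angle.cos_coe]))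
  have h0 : 0 < circleDeriv f (0 : ℝ) := hf_pos _ (by
    rw [Real.Angle.cos_coe]
    exact Real.cos_lt_cos_of_nonneg_of_le_pi le_rfl hbπ hb_pos)
  have hπ : circleDeriv f Real.pi < 0 := hf_neg _ (by
    rw [Real.Angle.cos_coe]
    exact Real.cos_lt_cos_of_nonneg_of_le_pi hb_pos.le le_rfl hb_lt)
  have hlift : ∀ μ : Fin p → Real.Angle, ∃ x : Fin p → ℝ, (fun j => (x j : Real.Angle)) = μ :=
    fun μ => ⟨fun j => (μ j).toReal, funext fun j => (μ j).coe_toReal⟩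
  obtain ⟨Z, hZ, hker⟩ := exists_null_forall_flowBalance_eq_zero
    (eq_zero_of_transpose_reducedIncidence_mulVec_eq_zero hG edge horient hne) hf
    (V := {circleDeriv f (0 : ℝ), circleDeriv f Real.pi}) (Set.toFinite _).countable
    (by
      rintro (h | h)
      · exact h0.ne h
      · exact hπ.ne' h)
    (fun t ht => by
      -- The zeros of the coupling are known on (-π, π], so t is replaced by its representative
      -- there.
      rw [← circleDeriv_coe, ← Real.Angle.coe_toReal (t : Real.Angle)]
      rcases hzero _ (Real.Angle.neg_pi_lt_toReal _) (Real.Angle.toReal_le_pi t)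
        (by rwa [Real.Angle.coe_toReal]) with h | h
      · exact Or.inl (by rw [h])
      · exact Or.inr (by rw [h]; rfl))
  refine ⟨Z, hZ, fun a ha => ⟨fun μ hμ => ?_, fun μ hμ => ?_⟩⟩
  · obtain ⟨x, rfl⟩ := hlift μ
    rw [← Matrix.mulVec_injective_iff_isUnit, ← Matrix.coe_mulVecLin,
      injective_iff_map_eq_zero]
    intro y hy
    refine hker a ha x ((coe_mem_reducedEquilibria_iff hB).1 hμ) y ?_
    rw [← reducedLaplacian_coe_mulVec]
    exact hy
  · obtain ⟨x, rfl⟩ := hlift μ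
    exact exists_isOpen_inter_reducedEquilibria_eq_singleton hfd hB hμ
      (hker a ha x ((coe_mem_reducedEquilibria_iff hB).1 hμ))
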